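/- Consider Dyck words $\sigma=(\sigma(1),\dots,\sigma(N))$ over $\{+,-\}$ (well-formed words, with $+$ the opening and $-$ the closing bracket). The ordered rooted forest $T(\sigma)$ associated with $\sigma$ is defined recursively by $T(\varepsilon)=\varepsilon$ and $T({+}\sigma_1{-}\sigma_2)=(T({+}\sigma_1{-}),T(\sigma_2))$ for Dyck words $\sigma_1,\sigma_2$, where $T({+}\sigma_1{-})$ is the tree in which the children of the root are the roots of the trees of $T(\sigma_1)$; the two displayed symbols $+$ and $-$ are said to be matched to each other in $\sigma$. A tree is binary if every node has at most two children. A re-pairing of $\sigma$ is a sequence of pairs $p=((\ell_1,r_1),\dots,(\ell_{N/2},r_{N/2}))$ with $\sigma(\ell_i)=+$, $\sigma(r_i)=-$ and $\ell_i<r_i$ for all $i$, in which every number from $[1,N]$ occurs in exactly one pair. It is simple if for every $i$ the symbols at positions $\ell_i$ and $r_i$ are matched to each other in $\sigma$. The width of a set of integers is the smallest number of intervals of integers whose union is that set, and the width of $p$ is the maximum over $t\in\{0,\dots,N/2\}$ of the width of the set $\{\ell_1,r_1,\dots,\ell_t,r_t\}$. Let $w(\sigma)$ denote the minimum width of a simple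 re-pairing of $\sigma$. The black-and-white pebble game on an acyclic directed graph $G$ starts with no pebbles on the nodes, and every node carries at most one pebble at any time. The moves are: place a black pebble on a node with no pebble all of whose immediate predecessors carry pebbles; remove a black pebble from any node; place a white pebble on any node with no pebble; remove a white pebble from a node all of whose immediate predecessors carry pebbles. A sequence of moves is successful if it reaches a configuration in which all sinks carry pebbles and no node carries a white pebble. Let $\mathrm{bw}(G)$ be the smallest $k$ such that there is a successful sequence of moves with at most $k$ pebbles on the graph at any time. A rooted tree is regarded as a directed graph with every edge directed from the child to its parent, so its only sink is the root. **Theorem.** There are absolute constants $c,C>0$ such that, for every Dyck word $\sigma$ for which the forest $D=T(\sigma)$ is a (possibly empty) binary tree, simple re-pairings of $\sigma$ and successful sequences of moves on $D$ exist, and $$c\cdot\mathrm{bw}(D)\;\le\; w(\sigma)\;\le\; C\cdot\mathrm{bw}(D).$$ -/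

import Mathlib

/-- Nonempty finite ordered rooted trees: a root with the ordered list of the subtrees rooted at its
children. -/
inductive OrderedTree : Type
  | node (children : List OrderedTree) : OrderedTree

namespace OrderedTree

/-- The subtrees rooted at the children of the root. -/
def children : OrderedTree → List OrderedTree
  | node cs => cs

/-- Every node has at most two children. -/
inductive IsBinary : OrderedTree → Prop
  | node (cs : List OrderedTree) (hlen : cs.length ≤ 2) (hcs : ∀ t ∈ cs, IsBinary t) :
      IsBinary (node cs)

end OrderedTree

/-- Ordered rooted forests: finite sequences of ordered rooted trees. -/
abbrev OrderedForest : Type := List OrderedTree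

namespace OrderedForest

/-- A forest is a tree (possibly the empty tree) if it has at most one component. -/
def IsTree (F : OrderedForest) : Prop := F.length ≤ 1

/-- Every node of the forest has at most two children. -/
def IsBinary (F : OrderedForest) : Prop := ∀ t ∈ F, t.IsBinary

/-- The subtree of the forest rooted at the node with a given address, if there is such a node:
`[i]` is the address of the root of the `i`-th tree, and `a ++ [i]` is the address of the `i`-th
child of the node with address `a` (counting from `0`). -/
def subtreeAt (F : OrderedForest) : List ℕ → Option OrderedTree
  | [] => none
  | [i] => F[i]?
  | i :: j :: a => F[i]?.bind fun t => subtreeAt t.children (j :: a)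

/-- The nodes of a forest, represented by their addresses. -/
abbrev Node (F : OrderedForest) : Type := {a : List ℕ // (subtreeAt F a).isSome}

/-- The forest as a directed graph, with the edges directed from each child to its parent. -/
def graph (F : OrderedForest) : Digraph F.Node where
  Adj u v := ∃ i : ℕ, u.1 = v.1 ++ [i]

end OrderedForest

namespace DyckWord

/-- The ordered rooted forest associated with a Dyck word: the forest of the empty word is empty, and
the forest of `+ σ₁ - σ₂` consists of the tree whose root has the trees of `σ₁` below it, followed
by the trees of `σ₂`. (For a nonempty word `+ σ₁ - σ₂`, Mathlib's `insidePart` is `σ₁` and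
`outsidePart` is `σ₂`.) -/
def forest (σ : DyckWord) : OrderedForest :=
  if h : σ = 0 then []
  else .node (forest σ.insidePart) :: forest σ.outsidePart
termination_by σ.semilength
decreasing_by exacts [semilength_insidePart_lt h, semilength_outsidePart_lt h]

/-- `Matched σ i j`: the symbols of `σ` at positions `i` and `j` (counted from `0`) are matched to
each other. In `+ σ₁ - σ₂`, which is written `σ₁.nest + σ₂`, the displayed `+` and `-` are matched,
and so are the symbols of `σ₁` and of `σ₂` that are matched in these words. -/
inductive Matched : DyckWord → ℕ → ℕ → Prop
  | outer (σ₁ σ₂ : DyckWord) :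
      Matched (σ₁.nest + σ₂) 0 (σ₁.toList.length + 1)
  | left (σ₁ σ₂ : DyckWord) (i j : ℕ) (h : Matched σ₁ i j) :
      Matched (σ₁.nest + σ₂) (i + 1) (j + 1)
  | right (σ₁ σ₂ : DyckWord) (i j : ℕ) (h : Matched σ₂ i j) :
      Matched (σ₁.nest + σ₂) (σ₁.toList.length + 2 + i) (σ₁.toList.length + 2 + j)

/-- `p` is a re-pairing of `σ`: a sequence of `|σ| / 2` pairs of positions (counted from `0`), each
consisting of a plus and of a minus to the right of it, such that every position of `σ` occurs in
exactly one pair. -/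
structure IsRepairing (σ : DyckWord) (p : List (ℕ × ℕ)) : Prop where
  length_eq : p.length = σ.semilength
  signs : ∀ q ∈ p, σ.toList[q.1]? = some DyckStep.U ∧ σ.toList[q.2]? = some DyckStep.D ∧ q.1 < q.2
  exactly_one : ∀ i < σ.toList.length, ∃! k : Fin p.length, (p.get k).1 = i ∨ (p.get k).2 = i

/-- A re-pairing is simple if it always pairs up two symbols that are matched in the word. -/
structure IsSimpleRepairing (σ : DyckWord) (p : List (ℕ × ℕ)) : Prop extends IsRepairing σ p where
  simple : ∀ q ∈ p, σ.Matched q.1 q.2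

end DyckWord

namespace Repairing

/-- The width of a set of integers (here: of positions in a word): the smallest number of intervals
`[a, b]` whose union is the set. -/
noncomputable def setWidth (S : Set ℕ) : ℕ :=
  sInf {k : ℕ | ∃ I : Fin k → ℕ × ℕ, (⋃ m, Set.Icc (I m).1 (I m).2) = S}

/-- The set of positions erased by the first `t` pairs. -/
def erased (p : List (ℕ × ℕ)) (t : ℕ) : Set ℕ :=
  {b : ℕ | ∃ q ∈ p.take t, b = q.1 ∨ b = q.2}

/-- The width of a re-pairing: the maximum over all times of the width of the erased set. -/
noncomputable def width (p : List (ℕ × ℕ)) : ℕ :=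
  (Finset.range (p.length + 1)).sup fun t => setWidth (erased p t)

end Repairing

namespace DyckWord

/-- The set of all widths of simple re-pairings of `σ`. -/
def simpleWidths (σ : DyckWord) : Set ℕ :=
  {w : ℕ | ∃ p : List (ℕ × ℕ), σ.IsSimpleRepairing p ∧ Repairing.width p = w}

/-- The minimum width of a simple re-pairing of `σ`. -/
noncomputable def minSimpleWidth (σ : DyckWord) : ℕ := sInf σ.simpleWidths

end DyckWord

namespace Pebbling

/-- The two colours of pebbles. -/
inductive Pebble : Type
  | black
  | white

/-- A configuration: every node carries no pebble, a black pebble, or a white pebble. -/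
abbrev Config (V : Type*) : Type _ := V → Option Pebble

/-- The number of pebbles in a configuration. (Only finitely many nodes carry pebbles at any time
of the game.) -/
noncomputable def Config.numPebbles {V : Type*} (c : Config V) : ℕ := {v : V | c v ≠ none}.ncard

/-- All immediate predecessors of `v` carry pebbles. -/
def PredecessorsPebbled {V : Type*} (G : Digraph V) (c : Config V) (v : V) : Prop :=
  ∀ u : V, G.Adj u v → c u ≠ none

/-- The moves of the black-and-white pebble game. -/
inductive Move {V : Type*} [DecidableEq V] (G : Digraph V) : Config V → Config V → Prop
  | placeBlack (c : Config V) (v : V) (hv : c v = none) (hpred : PredecessorsPebbled G c v) :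
      Move G c (Function.update c v (some Pebble.black))
  | removeBlack (c : Config V) (v : V) (hv : c v = some Pebble.black) :
      Move G c (Function.update c v none)
  | placeWhite (c : Config V) (v : V) (hv : c v = none) :
      Move G c (Function.update c v (some Pebble.white))
  | removeWhite (c : Config V) (v : V) (hv : c v = some Pebble.white)
      (hpred : PredecessorsPebbled G c v) :
      Move G c (Function.update c v none)

/-- A strategy, given by the sequence of configurations that it goes through: it starts with no
pebbles, and each configuration is obtained from the previous one by a move. -/
structure IsStrategy {V : Type*} [DecidableEq V] (G : Digraph V) (s : List (Config V)) : Prop where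
  start : s.head? = some fun _ => none
  moves : s.IsChain (Move G)

/-- The goal: all sinks carry pebbles and there are no white pebbles. -/
def IsGoal {V : Type*} (G : Digraph V) (c : Config V) : Prop :=
  (∀ v : V, (∀ u : V, ¬ G.Adj v u) → c v ≠ none) ∧ ∀ v : V, c v ≠ some Pebble.white

/-- The numbers of pebbles that are sufficient for a successful strategy. -/
def sufficientPebbles {V : Type*} [DecidableEq V] (G : Digraph V) : Set ℕ :=
  {k : ℕ | ∃ s : List (Config V), IsStrategy G s ∧ (∃ c ∈ s, IsGoal G c) ∧
    ∀ c ∈ s, c.numPebbles ≤ k}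

/-- The black-and-white pebbling number: the minimum number of pebbles sufficient for a successful
strategy. -/
noncomputable def bw {V : Type*} [DecidableEq V] (G : Digraph V) : ℕ := sInf (sufficientPebbles G)

end Pebbling

/-!
List the nodes of the forest in some order and say that a node is *split* by an initial segment `S`
of the list if an edge from one of its children to it has exactly one end in `S`. Both quantities
are comparable to the least `m` such that, for some order, no `S` splits more than `m` nodes.

*Width.* The simple re-pairings are the lists of all nodes, each node standing for its two brackets.
Directly inside each split node, somewhere between its brackets, the set of erased positions has a
boundary, so `m` is at most twice the width. Conversely, the right end of a maximal interval of
erased positions is the opening bracket of a split node, the closing bracket of a child of a split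
node, or the closing bracket of a root.

*From a list to pebbles.* Call a node done if it and all its children belong to `S`. Take the nodes
one by one: put a white pebble on the node, make the pebbles of all done nodes black, and remove
those whose parent is done as well. The pebbled nodes are then split nodes, children of split nodes
and roots.

*From pebbles to a list.* Going down the forest, choose for every node an interval of time in which
it carries a pebble, such that at one end of the interval all its children carry pebbles, and let
the intervals of the children start from that time. List the nodes by the left ends of their
intervals. As the intervals of a node and its child intersect, one of them contains the time that
separates `S` from the other nodes whenever exactly one of the two nodes is in `S`.
-/

namespace Pebbling

variable {V : Type*} {G : Digraph V}

/-- The nodes without a successor. -/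
def sinks (G : Digraph V) : Set V := {v | ∀ u, ¬ G.Adj v u}

/-- The immediate predecessors of the nodes in `M`. -/
def predecessors (G : Digraph V) (M : Set V) : Set V := {x | ∃ w ∈ M, G.Adj x w}

/-- The nodes separated by `S` from one of their immediate predecessors. Their number is the measure
of complexity of a set of nodes through which re-pairings and pebblings are compared. -/
def splitNodes (G : Digraph V) (S : Set V) : Set V := {w | ∃ x, G.Adj x w ∧ ¬ (x ∈ S ↔ w ∈ S)}

lemma ncard_predecessors_le [Finite V] {d : ℕ} (hd : ∀ w, {x | G.Adj x w}.ncard ≤ d) (M : Set V) :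
    (predecessors G M).ncard ≤ d * M.ncard := by
  have hM := M.toFinite
  have hunion : predecessors G M = ⋃ w ∈ hM.toFinset, {x | G.Adj x w} := by
    ext x
    simp [predecessors]
  calc (predecessors G M).ncard ≤ ∑ w ∈ hM.toFinset, {x | G.Adj x w}.ncard :=
        hunion ▸ Finset.set_ncard_biUnion_le _ _
    _ ≤ hM.toFinset.card * d := Finset.sum_le_card_nsmul _ _ _ fun w _ => hd w
    _ = d * M.ncard := by rw [← Set.ncard_eq_toFinset_card M hM, mul_comm]

end Pebbling

namespace OrderedForest

open Pebbling

variable {F : OrderedForest}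

@[simp] lemma subtreeAt_nil (F : OrderedForest) : F.subtreeAt [] = none := rfl

lemma subtreeAt_append_singleton (F : OrderedForest) {a : List ℕ} (ha : a ≠ []) (i : ℕ) :
    F.subtreeAt (a ++ [i]) = (F.subtreeAt a).bind fun t => t.children[i]? := by
  induction a generalizing F with
  | nil => exact absurd rfl ha
  | cons j a ih =>
    rcases a with _ | ⟨l, a⟩
    · simp [subtreeAt]
    · simp only [List.cons_append, subtreeAt, Option.bind_assoc]
      congr 1
      funext t
      exact ih t.children (by simp)

lemma isSome_subtreeAt_of_append_singleton {a : List ℕ} (ha : a ≠ []) {i : ℕ}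
    (h : (F.subtreeAt (a ++ [i])).isSome) : (F.subtreeAt a).isSome := by
  rw [subtreeAt_append_singleton F ha] at h
  exact Option.isSome_of_isSome_bind h

lemma isSome_subtreeAt_singleton {i : ℕ} : (F.subtreeAt [i]).isSome ↔ i < F.length := by
  simp [subtreeAt]

lemma IsBinary.subtreeAt (hF : F.IsBinary) {a : List ℕ} {t : OrderedTree}
    (h : F.subtreeAt a = some t) : t.IsBinary := by
  induction a using List.reverseRecOn generalizing t with
  | nil => simp at h
  | append_singleton a i ih =>
    rcases eq_or_ne a [] with rfl | ha
    · exact hF t (List.mem_of_getElem? (i := i) h)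
    · rw [subtreeAt_append_singleton F ha, Option.bind_eq_some_iff] at h
      obtain ⟨t', ht', hi⟩ := h
      obtain ⟨cs, -, hcs⟩ := ih ht'
      exact hcs t (List.mem_of_getElem? hi)

lemma Node.ne_nil (v : F.Node) : v.1 ≠ [] := by
  intro h
  simpa [h] using v.2

lemma IsBinary.ncard_children_le_two (hF : F.IsBinary) (w : F.Node) :
    {x | F.graph.Adj x w}.ncard ≤ 2 := by
  have hsub : Subtype.val '' {x | F.graph.Adj x w} ⊆ {w.1 ++ [0], w.1 ++ [1]} := by
    rintro _ ⟨x, ⟨i, hi⟩, rfl⟩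
    have hx := x.2
    rw [hi, subtreeAt_append_singleton F w.ne_nil] at hx
    obtain ⟨t, ht⟩ := Option.isSome_iff_exists.1 w.2
    obtain ⟨cs, hlen, -⟩ := hF.subtreeAt ht
    have : i < cs.length := by simpa [ht, OrderedTree.children] using hx
    have : i < 2 := by omega
    interval_cases i <;> simp [hi]
  rw [← Set.ncard_image_of_injective _ Subtype.val_injective]
  calc _ ≤ ({w.1 ++ [0], w.1 ++ [1]} : Set (List ℕ)).ncard := Set.ncard_le_ncard hsub
    _ ≤ ({w.1 ++ [1]} : Set (List ℕ)).ncard + 1 := Set.ncard_insert_le _ _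
    _ = 2 := by rw [Set.ncard_singleton]

lemma graph_rightUnique : Relator.RightUnique F.graph.Adj := by
  rintro u v w ⟨i, hi⟩ ⟨j, hj⟩
  exact Subtype.ext (List.append_inj_left' (hi.symm.trans hj) rfl)

lemma graph_irrefl : Std.Irrefl F.graph.Adj where
  irrefl := by
    rintro v ⟨i, hi⟩
    simpa using congrArg List.length hi

lemma mem_sinks_of_eq_singleton {v : F.Node} {i : ℕ} (hv : v.1 = [i]) : v ∈ sinks F.graph := by
  rintro w ⟨j, hj⟩
  have hw : [] ++ [i] = w.1 ++ [j] := hv.symm.trans hj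
  exact w.ne_nil (List.append_inj_left' hw rfl).symm

lemma exists_adj_of_eq_append_singleton {v : F.Node} {a : List ℕ} {i : ℕ} (hv : v.1 = a ++ [i])
    (ha : a ≠ []) : ∃ w : F.Node, w.1 = a ∧ F.graph.Adj v w :=
  ⟨⟨a, isSome_subtreeAt_of_append_singleton ha (hv ▸ v.2)⟩, rfl, i, hv⟩

lemma exists_eq_singleton_of_mem_sinks {v : F.Node} (hv : v ∈ sinks F.graph) :
    ∃ i, v.1 = [i] := by
  obtain ⟨a, i, hai⟩ := List.eq_nil_or_concat' v.1 |>.resolve_left v.ne_nil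
  rcases eq_or_ne a [] with rfl | ha
  · exact ⟨i, hai⟩
  · obtain ⟨w, -, hw⟩ := exists_adj_of_eq_append_singleton hai ha
    exact absurd hw (hv w)

lemma ncard_sinks_le_length (F : OrderedForest) : (sinks F.graph).ncard ≤ F.length := by
  have hsub : Subtype.val '' sinks F.graph ⊆ (fun i => [i]) '' Set.Iio F.length := by
    rintro _ ⟨v, hv, rfl⟩
    obtain ⟨i, hi⟩ := exists_eq_singleton_of_mem_sinks hv
    exact ⟨i, isSome_subtreeAt_singleton.1 (hi ▸ v.2), hi.symm⟩
  calc (sinks F.graph).ncard = (Subtype.val '' sinks F.graph).ncard :=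
        (Set.ncard_image_of_injective _ Subtype.val_injective).symm
    _ ≤ ((fun i => [i]) '' Set.Iio F.length).ncard :=
        Set.ncard_le_ncard hsub ((Set.finite_Iio _).image _)
    _ ≤ (Set.Iio F.length).ncard := Set.ncard_image_le (Set.finite_Iio _)
    _ = F.length := by simp

/-- The empty address stands for a virtual parent of all roots, at which the choice is `x₀`. -/
lemma exists_topDown_choice {α : Type*} {Q : F.Node → α → Prop} {R : F.Node → α → α → Prop}
    {x₀ : α} (root : ∀ v ∈ sinks F.graph, Q v x₀)
    (step : ∀ v x, Q v x → ∃ y, R v x y ∧ ∀ u, F.graph.Adj u v → Q u y) :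
    ∃ e : List ℕ → α, ∀ v : F.Node, R v (e v.1.dropLast) (e v.1) := by
  classical
  have : Nonempty α := ⟨x₀⟩
  choose! next hR hQ using step
  let e : List ℕ → α := fun a => List.reverseRecOn a x₀ fun a i x =>
    if h : (F.subtreeAt (a ++ [i])).isSome then next ⟨a ++ [i], h⟩ x else x
  have e_append (a : List ℕ) (i : ℕ) (h : (F.subtreeAt (a ++ [i])).isSome) :
      e (a ++ [i]) = next ⟨a ++ [i], h⟩ (e a) := by
    simp [e, h]
  have e_node (v : F.Node) : e v.1 = next v (e v.1.dropLast) := by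
    obtain ⟨a, i, hai⟩ := List.eq_nil_or_concat' v.1 |>.resolve_left v.ne_nil
    obtain ⟨_, hv⟩ := v
    subst hai
    simpa using e_append a i hv
  suffices hQe : ∀ (a : List ℕ) (v : F.Node), v.1 = a → Q v (e a.dropLast) by
    exact ⟨e, fun v => e_node v ▸ hR v _ (hQe _ v rfl)⟩
  intro a
  induction a using List.reverseRecOn with
  | nil => exact fun v hv => absurd hv v.ne_nil
  | append_singleton a i ih =>
    intro v hv
    rw [List.dropLast_concat]
    rcases eq_or_ne a [] with rfl | ha
    · simpa [e] using root v (mem_sinks_of_eq_singleton hv)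
    · obtain ⟨w, rfl, hw⟩ := exists_adj_of_eq_append_singleton hv ha
      exact e_node w ▸ hQ w _ (ih w rfl) v hw

end OrderedForest

namespace Repairing

variable {S : Set ℕ}

/-- The intervals are the maximal ones; they are indexed by their right endpoints. -/
lemma exists_iUnion_Icc_eq (hS : S.Finite) :
    ∃ I : Fin {i ∈ S | i + 1 ∉ S}.ncard → ℕ × ℕ, (⋃ m, Set.Icc (I m).1 (I m).2) = S := by
  classical
  set R := {i ∈ S | i + 1 ∉ S}
  have := (hS.subset (Set.sep_subset _ _) : R.Finite).to_subtype
  have e : Fin R.ncard ≃ R := (Finite.equivFinOfCardEq rfl).symm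
  have hstart (i : R) : ∃ a, Set.Icc a i.1 ⊆ S := ⟨i.1, by simpa using i.2.1⟩
  refine ⟨fun m => (Nat.find (hstart (e m)), (e m).1), Set.Subset.antisymm
    (Set.iUnion_subset fun m => Nat.find_spec (hstart (e m))) fun x hx => ?_⟩
  have hend : ∃ i, x ≤ i ∧ i + 1 ∉ S := by
    obtain ⟨M, hM⟩ := hS.bddAbove
    exact ⟨max x M, le_max_left _ _, fun h => by have := hM h; omega⟩
  obtain ⟨hxi, hi⟩ := Nat.find_spec hend
  have hsub : Set.Icc x (Nat.find hend) ⊆ S := by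
    intro y hy
    induction y, hy.1 using Nat.le_induction with
    | base => exact hx
    | succ y hxy _ =>
      by_contra hy'
      exact Nat.find_min hend hy.2 ⟨hxy, hy'⟩
  refine Set.mem_iUnion.2 ⟨e.symm ⟨Nat.find hend, hsub ⟨hxi, le_rfl⟩, hi⟩, ?_⟩
  simp only [Equiv.apply_symm_apply]
  exact ⟨Nat.find_min' _ hsub, hxi⟩

lemma setWidth_le_ncard (hS : S.Finite) : setWidth S ≤ {i ∈ S | i + 1 ∉ S}.ncard :=
  Nat.sInf_le (exists_iUnion_Icc_eq hS)

lemma exists_iUnion_Icc_eq_of_setWidth (hS : S.Finite) :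
    ∃ I : Fin (setWidth S) → ℕ × ℕ, (⋃ m, Set.Icc (I m).1 (I m).2) = S :=
  Nat.sInf_mem (s := {k | ∃ I : Fin k → ℕ × ℕ, (⋃ m, Set.Icc (I m).1 (I m).2) = S})
    ⟨_, exists_iUnion_Icc_eq hS⟩

lemma ncard_boundary_le_two_mul_setWidth (hS : S.Finite) :
    {i | ¬ (i ∈ S ↔ i + 1 ∈ S)}.ncard ≤ 2 * setWidth S := by
  obtain ⟨I, hI⟩ := exists_iUnion_Icc_eq_of_setWidth hS
  have hsub : {i | ¬ (i ∈ S ↔ i + 1 ∈ S)} ⊆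
      (Set.range fun m => (I m).1 - 1) ∪ Set.range fun m => (I m).2 := by
    intro i hi
    simp only [← hI, Set.mem_ofPred_eq, Set.mem_iUnion, Set.mem_Icc] at hi
    by_contra h
    simp only [Set.mem_union, Set.mem_range, not_or, not_exists] at h
    refine hi (exists_congr fun m => ?_)
    have := h.1 m
    have := h.2 m
    omega
  have hrange (f : Fin (setWidth S) → ℕ) : (Set.range f).ncard ≤ setWidth S := by
    simpa using Set.ncard_image_le (f := f) Set.finite_univ
  calc _ ≤ _ := Set.ncard_le_ncard hsub ((Set.finite_range _).union (Set.finite_range _))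
    _ ≤ _ := Set.ncard_union_le _ _
    _ ≤ 2 * setWidth S := by linarith [hrange fun m => (I m).1 - 1, hrange fun m => (I m).2]

lemma setWidth_pos (hS : S.Finite) (hne : S.Nonempty) : 0 < setWidth S := by
  obtain ⟨I, hI⟩ := exists_iUnion_Icc_eq_of_setWidth hS
  obtain ⟨i, hi⟩ := hne
  obtain ⟨m, -⟩ := Set.mem_iUnion.1 (hI ▸ hi)
  exact m.pos

lemma finite_erased (p : List (ℕ × ℕ)) (t : ℕ) : (erased p t).Finite := by
  refine (((p.take t).map Prod.fst).toFinset ∪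
    ((p.take t).map Prod.snd).toFinset).finite_toSet.subset ?_
  rintro b ⟨q, hq, rfl | rfl⟩ <;> simp only [Finset.coe_union, List.coe_toFinset, List.mem_map]
  · exact .inl ⟨q, hq, rfl⟩
  · exact .inr ⟨q, hq, rfl⟩

lemma setWidth_erased_le_width {p : List (ℕ × ℕ)} {t : ℕ} (ht : t ≤ p.length) :
    setWidth (erased p t) ≤ width p :=
  Finset.le_sup (f := fun t => setWidth (erased p t)) (Finset.mem_range.2 (by omega))

lemma width_pos {p : List (ℕ × ℕ)} (hp : p ≠ []) : 0 < width p := by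
  have hne : (erased p p.length).Nonempty :=
    ⟨(p.head hp).1, p.head hp, by rw [List.take_length]; exact p.head_mem hp, .inl rfl⟩
  exact (setWidth_pos (finite_erased _ _) hne).trans_le (setWidth_erased_le_width le_rfl)

end Repairing

namespace Bracketing

open DyckStep OrderedForest Pebbling Repairing

variable {σ : DyckWord}

@[elab_as_elim]
theorem nest_add_induction {P : DyckWord → Prop} (zero : P 0)
    (nest_add : ∀ σ₁ σ₂ : DyckWord, P σ₁ → P σ₂ → P (σ₁.nest + σ₂)) (σ : DyckWord) : P σ := by
  by_cases h : σ = 0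
  · exact h ▸ zero
  · have inside := nest_add_induction zero nest_add σ.insidePart
    have outside := nest_add_induction zero nest_add σ.outsidePart
    exact DyckWord.nest_insidePart_add_outsidePart h ▸ nest_add _ _ inside outside
termination_by σ.semilength
decreasing_by
  exacts [DyckWord.semilength_insidePart_lt h, DyckWord.semilength_outsidePart_lt h]

section NestAdd

variable (σ₁ σ₂ : DyckWord)

lemma nest_add_ne_zero : σ₁.nest + σ₂ ≠ 0 := by
  simp [← DyckWord.toList_ne_nil, DyckWord.nest]

lemma insidePart_nest_add : (σ₁.nest + σ₂).insidePart = σ₁ := by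
  rw [DyckWord.insidePart_add DyckWord.nest_ne_zero, DyckWord.insidePart_nest]

lemma outsidePart_nest_add : (σ₁.nest + σ₂).outsidePart = σ₂ := by
  rw [DyckWord.outsidePart_add DyckWord.nest_ne_zero, DyckWord.outsidePart_nest, zero_add]

lemma toList_nest_add : (σ₁.nest + σ₂).toList = U :: (σ₁.toList ++ D :: σ₂.toList) := by
  change σ₁.nest.toList ++ σ₂.toList = _
  simp [DyckWord.nest]

lemma forest_nest_add : (σ₁.nest + σ₂).forest = .node σ₁.forest :: σ₂.forest := by
  rw [DyckWord.forest, dif_neg (nest_add_ne_zero σ₁ σ₂), insidePart_nest_add, outsidePart_nest_add]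

end NestAdd

@[simp] lemma forest_zero : DyckWord.forest 0 = [] := by
  rw [DyckWord.forest]; simp

/-- The symbols of a Dyck word, each with the address of the node of the forest that it delimits.
The trees of the forest get the addresses `b ++ [k]`, `b ++ [k + 1]`, and so on, so that the
labelling of a subword has the same form; the addresses of `σ.forest` are those of
`labels σ [] 0`. -/
def labels (σ : DyckWord) (b : List ℕ) (k : ℕ) : List (DyckStep × List ℕ) :=
  if h : σ = 0 then []
  else (U, b ++ [k]) :: (labels σ.insidePart (b ++ [k]) 0 ++
    (D, b ++ [k]) :: labels σ.outsidePart b (k + 1))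
termination_by σ.semilength
decreasing_by
  exacts [DyckWord.semilength_insidePart_lt h, DyckWord.semilength_outsidePart_lt h]

@[simp] lemma labels_zero (b : List ℕ) (k : ℕ) : labels 0 b k = [] := by
  rw [labels]; simp

lemma labels_nest_add (σ₁ σ₂ : DyckWord) (b : List ℕ) (k : ℕ) :
    labels (σ₁.nest + σ₂) b k = (U, b ++ [k]) :: (labels σ₁ (b ++ [k]) 0 ++
      (D, b ++ [k]) :: labels σ₂ b (k + 1)) := by
  rw [labels, dif_neg (nest_add_ne_zero σ₁ σ₂), insidePart_nest_add, outsidePart_nest_add]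

lemma map_fst_labels (σ : DyckWord) (b : List ℕ) (k : ℕ) :
    (labels σ b k).map Prod.fst = σ.toList := by
  induction σ using nest_add_induction generalizing b k with
  | zero => rw [labels_zero]; rfl
  | nest_add σ₁ σ₂ ih₁ ih₂ => simp [labels_nest_add, toList_nest_add, ih₁, ih₂]

lemma length_labels (σ : DyckWord) (b : List ℕ) (k : ℕ) :
    (labels σ b k).length = σ.toList.length := by
  rw [← map_fst_labels σ b k, List.length_map]

lemma mem_labels {b : List ℕ} {k : ℕ} {x : DyckStep × List ℕ} :
    x ∈ labels σ b k ↔ ∃ (j : ℕ) (a : List ℕ), x.2 = b ++ (k + j) :: a ∧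
      (σ.forest.subtreeAt (j :: a)).isSome := by
  induction σ using nest_add_induction generalizing b k with
  | zero =>
    simp only [labels_zero, List.not_mem_nil, forest_zero, false_iff, not_exists, not_and]
    rintro j (_ | _) _ <;> simp [subtreeAt]
  | nest_add σ₁ σ₂ ih₁ ih₂ =>
    obtain ⟨s, v⟩ := x
    rw [labels_nest_add, forest_nest_add]
    simp only [List.mem_cons, List.mem_append, ih₁, ih₂, Prod.mk.injEq]
    constructor
    · rintro (⟨-, rfl⟩ | ⟨j, a, rfl, h⟩ | ⟨-, rfl⟩ | ⟨j, a, rfl, h⟩)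
      · exact ⟨0, [], by simp, by simp [subtreeAt]⟩
      · exact ⟨0, j :: a, by simp, by simpa [subtreeAt, OrderedTree.children] using h⟩
      · exact ⟨0, [], by simp, by simp [subtreeAt]⟩
      · have hindex : b ++ (k + 1 + j) :: a = b ++ (k + (j + 1)) :: a := by congr 2; omega
        refine ⟨j + 1, a, hindex, ?_⟩
        cases a <;> simpa [subtreeAt] using h
    · rintro ⟨_ | j, a, rfl, h⟩
      · rcases a with _ | ⟨i, a⟩
        · cases s <;> simp
        · right; left
          exact ⟨i, a, by simp, by simpa [subtreeAt, OrderedTree.children] using h⟩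
      · right; right; right
        have hindex : b ++ (k + (j + 1)) :: a = b ++ (k + 1 + j) :: a := by congr 2; omega
        refine ⟨j, a, hindex, ?_⟩
        cases a <;> simpa [subtreeAt] using h

lemma nodup_labels (σ : DyckWord) (b : List ℕ) (k : ℕ) : (labels σ b k).Nodup := by
  induction σ using nest_add_induction generalizing b k with
  | zero => simp
  | nest_add σ₁ σ₂ ih₁ ih₂ =>
    have inside (x) (hx : x ∈ labels σ₁ (b ++ [k]) 0) : ∃ j a, x.2 = b ++ k :: j :: a := by
      obtain ⟨j, a, h, -⟩ := mem_labels.1 hx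
      exact ⟨j, a, by simpa using h⟩
    have outside (x) (hx : x ∈ labels σ₂ b (k + 1)) : ∃ j a, x.2 = b ++ (k + 1 + j) :: a := by
      obtain ⟨j, a, h, -⟩ := mem_labels.1 hx
      exact ⟨j, a, h⟩
    have root_notMem_inside (s) : (s, b ++ [k]) ∉ labels σ₁ (b ++ [k]) 0 := by
      intro h
      obtain ⟨j, a, h⟩ := inside _ h
      simp at h
    have root_notMem_outside (s) : (s, b ++ [k]) ∉ labels σ₂ b (k + 1) := by
      intro h
      obtain ⟨j, a, h⟩ := outside _ h
      simp only [List.append_cancel_left_eq, List.cons.injEq] at h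
      omega
    have disjoint : (labels σ₁ (b ++ [k]) 0).Disjoint (labels σ₂ b (k + 1)) := by
      intro x h₁ h₂
      obtain ⟨j, a, h⟩ := inside x h₁
      obtain ⟨j', a', h'⟩ := outside x h₂
      simp only [h, List.append_cancel_left_eq, List.cons.injEq] at h'
      omega
    rw [labels_nest_add, List.nodup_cons, List.nodup_append', List.nodup_cons]
    simp_all [List.disjoint_cons_right]

/-- The possible pairs of consecutive labels. -/
inductive NextLabel : DyckStep × List ℕ → DyckStep × List ℕ → Prop
  | down (a : List ℕ) : NextLabel (U, a) (U, a ++ [0])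
  | leaf (a : List ℕ) : NextLabel (U, a) (D, a)
  | sibling (a : List ℕ) (j : ℕ) : NextLabel (D, a ++ [j]) (U, a ++ [j + 1])
  | up (a : List ℕ) (j : ℕ) : NextLabel (D, a ++ [j]) (D, a)

lemma eq_of_mem_head?_labels {b : List ℕ} {k : ℕ} {x : DyckStep × List ℕ}
    (h : x ∈ (labels σ b k).head?) : x = (U, b ++ [k]) := by
  induction σ using nest_add_induction with
  | zero => simp at h
  | nest_add σ₁ σ₂ _ _ => simpa [labels_nest_add, eq_comm] using h

lemma exists_eq_of_mem_getLast?_labels {b : List ℕ} {k : ℕ} {x : DyckStep × List ℕ}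
    (h : x ∈ (labels σ b k).getLast?) : ∃ j, x = (D, b ++ [j]) := by
  induction σ using nest_add_induction generalizing k with
  | zero => simp at h
  | nest_add σ₁ σ₂ _ ih =>
    rw [labels_nest_add, ← List.cons_append, List.getLast?_append_cons] at h
    rcases hl : labels σ₂ b (k + 1) with _ | ⟨y, l⟩
    · exact ⟨k, by simpa [hl, eq_comm] using h⟩
    · rw [hl, List.getLast?_cons_cons, ← hl] at h
      exact ih h

lemma isChain_labels (σ : DyckWord) (b : List ℕ) (k : ℕ) : (labels σ b k).IsChain NextLabel := by
  induction σ using nest_add_induction generalizing b k with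
  | zero => simp
  | nest_add σ₁ σ₂ ih₁ ih₂ =>
    rw [labels_nest_add, List.isChain_cons, List.isChain_append, List.isChain_cons]
    refine ⟨?_, ih₁ _ _, ⟨?_, ih₂ _ _⟩, ?_⟩
    · intro y hy
      rcases hl : labels σ₁ (b ++ [k]) 0 with _ | ⟨z, l⟩
      · obtain rfl : (D, b ++ [k]) = y := by simpa [hl] using hy
        exact .leaf _
      · obtain rfl : z = y := by simpa [hl] using hy
        have hz : z = (U, b ++ [k] ++ [0]) := eq_of_mem_head?_labels (σ := σ₁) (by simp [hl])
        exact hz ▸ .down _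
    · intro y hy
      rw [eq_of_mem_head?_labels hy]
      exact .sibling _ _
    · intro x hx y hy
      obtain ⟨j, rfl⟩ := exists_eq_of_mem_getLast?_labels hx
      obtain rfl : (D, b ++ [k]) = y := by simpa using hy
      exact .up _ _

section Matched

lemma getElem?_labels_inside {σ₁ σ₂ : DyckWord} {b : List ℕ} {k i : ℕ} {x : DyckStep × List ℕ}
    (h : (labels σ₁ (b ++ [k]) 0)[i]? = some x) :
    (labels (σ₁.nest + σ₂) b k)[i + 1]? = some x := by
  rw [labels_nest_add, List.getElem?_cons_succ,
    List.getElem?_append_left (List.getElem?_eq_some_iff.1 h).1, h]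

lemma getElem?_labels_open (σ₁ σ₂ : DyckWord) (b : List ℕ) (k : ℕ) :
    (labels (σ₁.nest + σ₂) b k)[0]? = some (U, b ++ [k]) := by
  rw [labels_nest_add, List.getElem?_cons_zero]

lemma getElem?_labels_close (σ₁ σ₂ : DyckWord) (b : List ℕ) (k : ℕ) :
    (labels (σ₁.nest + σ₂) b k)[σ₁.toList.length + 1]? = some (D, b ++ [k]) := by
  rw [labels_nest_add, List.getElem?_cons_succ, ← length_labels σ₁ (b ++ [k]) 0]
  simp

lemma getElem?_labels_outside (σ₁ σ₂ : DyckWord) (b : List ℕ) (k i : ℕ) :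
    (labels (σ₁.nest + σ₂) b k)[σ₁.toList.length + 2 + i]? = (labels σ₂ b (k + 1))[i]? := by
  rw [labels_nest_add, ← length_labels σ₁ (b ++ [k]) 0,
    show (labels σ₁ (b ++ [k]) 0).length + 2 + i = (labels σ₁ (b ++ [k]) 0).length + (i + 1) + 1
      by omega, List.getElem?_cons_succ, List.getElem?_append_right (by omega),
    Nat.add_sub_cancel_left, List.getElem?_cons_succ]

lemma exists_labels_of_matched {i j : ℕ} (h : σ.Matched i j) (b : List ℕ) (k : ℕ) :
    ∃ a, (labels σ b k)[i]? = some (U, a) ∧ (labels σ b k)[j]? = some (D, a) := by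
  induction h generalizing b k with
  | outer σ₁ σ₂ => exact ⟨b ++ [k], getElem?_labels_open .., getElem?_labels_close ..⟩
  | left σ₁ σ₂ i j _ ih =>
    obtain ⟨a, hi, hj⟩ := ih (b ++ [k]) 0
    exact ⟨a, getElem?_labels_inside hi, getElem?_labels_inside hj⟩
  | right σ₁ σ₂ i j _ ih =>
    obtain ⟨a, hi, hj⟩ := ih b (k + 1)
    exact ⟨a, by rw [getElem?_labels_outside, hi], by rw [getElem?_labels_outside, hj]⟩

lemma exists_matched_of_mem_labels {b : List ℕ} {k : ℕ} {x : DyckStep × List ℕ}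
    (hx : x ∈ labels σ b k) : ∃ i j, σ.Matched i j ∧
      (labels σ b k)[i]? = some (U, x.2) ∧ (labels σ b k)[j]? = some (D, x.2) := by
  induction σ using nest_add_induction generalizing b k with
  | zero => simp at hx
  | nest_add σ₁ σ₂ ih₁ ih₂ =>
    have root : ∃ i j, (σ₁.nest + σ₂).Matched i j ∧
        (labels (σ₁.nest + σ₂) b k)[i]? = some (U, b ++ [k]) ∧
        (labels (σ₁.nest + σ₂) b k)[j]? = some (D, b ++ [k]) :=
      ⟨_, _, .outer σ₁ σ₂, getElem?_labels_open .., getElem?_labels_close ..⟩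
    simp only [labels_nest_add, List.mem_cons, List.mem_append] at hx
    rcases hx with rfl | hx | rfl | hx
    · exact root
    · obtain ⟨i, j, hm, hi, hj⟩ := ih₁ hx
      exact ⟨_, _, .left σ₁ σ₂ i j hm, getElem?_labels_inside hi, getElem?_labels_inside hj⟩
    · exact root
    · obtain ⟨i, j, hm, hi, hj⟩ := ih₂ hx
      exact ⟨_, _, .right σ₁ σ₂ i j hm, by rw [getElem?_labels_outside, hi],
        by rw [getElem?_labels_outside, hj]⟩

lemma lt_of_matched {i j : ℕ} (h : σ.Matched i j) : i < j := by
  induction h <;> omega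

end Matched

lemma mem_labels_nil {x : DyckStep × List ℕ} :
    x ∈ labels σ [] 0 ↔ (σ.forest.subtreeAt x.2).isSome := by
  rw [mem_labels]
  constructor
  · rintro ⟨j, a, h, hs⟩
    simpa [h] using hs
  · intro h
    rcases hx : x.2 with _ | ⟨j, a⟩
    · simp [hx] at h
    · exact ⟨j, a, by simp, hx ▸ h⟩

instance finite_node (σ : DyckWord) : Finite σ.forest.Node := by
  refine Set.Finite.to_subtype (Set.Finite.subset
    ((labels σ [] 0).map Prod.snd).toFinset.finite_toSet fun a ha => ?_)
  simp only [List.coe_toFinset, Set.mem_ofPred_eq, List.mem_map]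
  exact ⟨(U, a), mem_labels_nil.2 ha, rfl⟩

/-- The position in the word of the opening bracket (`s = U`) or of the closing bracket (`s = D`) of
the node `v`. -/
def pos (s : DyckStep) (v : σ.forest.Node) : ℕ := (labels σ [] 0).idxOf (s, v.1)

lemma getElem?_labels_pos (s : DyckStep) (v : σ.forest.Node) :
    (labels σ [] 0)[pos s v]? = some (s, v.1) :=
  List.getElem?_idxOf (mem_labels_nil.2 v.2)

lemma eq_pos {i : ℕ} {s : DyckStep} {v : σ.forest.Node}
    (h : (labels σ [] 0)[i]? = some (s, v.1)) : i = pos s v :=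
  (List.getElem?_inj (List.getElem?_eq_some_iff.1 h).1 (nodup_labels σ [] 0)).1
    (h.trans (getElem?_labels_pos s v).symm)

lemma pos_injective {s s' : DyckStep} {v v' : σ.forest.Node} (h : pos s v = pos s' v') :
    s = s' ∧ v = v' := by
  have hlabel := getElem?_labels_pos s v
  rw [h, getElem?_labels_pos, Option.some_inj, Prod.mk.injEq] at hlabel
  exact ⟨hlabel.1.symm, Subtype.ext hlabel.2.symm⟩

lemma exists_pos_of_getElem?_labels {i : ℕ} {x : DyckStep × List ℕ}
    (h : (labels σ [] 0)[i]? = some x) : ∃ v : σ.forest.Node, x.2 = v.1 ∧ i = pos x.1 v :=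
  ⟨⟨x.2, mem_labels_nil.1 (List.mem_of_getElem? h)⟩, rfl, eq_pos h⟩

lemma exists_eq_pos {i : ℕ} (hi : i < σ.toList.length) :
    ∃ (s : DyckStep) (v : σ.forest.Node), i = pos s v := by
  rw [← length_labels σ [] 0] at hi
  obtain ⟨v, -, h⟩ := exists_pos_of_getElem?_labels (List.getElem?_eq_getElem hi)
  exact ⟨_, v, h⟩

lemma getElem?_toList_pos (s : DyckStep) (v : σ.forest.Node) :
    σ.toList[pos s v]? = some s := by
  rw [← map_fst_labels σ [] 0, List.getElem?_map, getElem?_labels_pos]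
  rfl

lemma matched_iff_exists_pos {i j : ℕ} :
    σ.Matched i j ↔ ∃ v : σ.forest.Node, i = pos U v ∧ j = pos D v := by
  constructor
  · intro h
    obtain ⟨a, hi, hj⟩ := exists_labels_of_matched h [] 0
    obtain ⟨v, rfl, hv⟩ := exists_pos_of_getElem?_labels hi
    exact ⟨v, hv, eq_pos hj⟩
  · rintro ⟨v, rfl, rfl⟩
    obtain ⟨i, j, h, hi, hj⟩ := exists_matched_of_mem_labels
      (List.mem_of_getElem? (getElem?_labels_pos U v))
    exact eq_pos hi ▸ eq_pos hj ▸ h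

lemma nextLabel_of_pos_eq_succ {s s' : DyckStep} {v v' : σ.forest.Node}
    (h : pos s' v' = pos s v + 1) : NextLabel (s, v.1) (s', v'.1) := by
  obtain ⟨_, hget⟩ := List.getElem?_eq_some_iff.1 (getElem?_labels_pos s v)
  obtain ⟨hlt', hget'⟩ := List.getElem?_eq_some_iff.1 (getElem?_labels_pos s' v')
  have hchain := List.isChain_iff_getElem.1 (isChain_labels σ [] 0) _ (h ▸ hlt')
  simpa only [← h, hget, hget'] using hchain

lemma mem_sinks_of_pos_eq_zero {v : σ.forest.Node} (h : pos U v = 0) :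
    v ∈ sinks σ.forest.graph := by
  have hhead := getElem?_labels_pos U v
  rw [h, ← List.head?_eq_getElem?] at hhead
  exact mem_sinks_of_eq_singleton (Prod.mk.inj (eq_of_mem_head?_labels hhead)).2

lemma eq_D_and_mem_sinks_of_last {s : DyckStep} {v : σ.forest.Node}
    (h : σ.toList.length ≤ pos s v + 1) : s = D ∧ v ∈ sinks σ.forest.graph := by
  have hlast := getElem?_labels_pos s v
  have hlt := (List.getElem?_eq_some_iff.1 hlast).1
  rw [← length_labels σ [] 0] at h
  rw [show pos s v = (labels σ [] 0).length - 1 by omega, ← List.getLast?_eq_getElem?] at hlast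
  obtain ⟨j, hj⟩ := exists_eq_of_mem_getLast?_labels hlast
  exact ⟨(Prod.mk.inj hj).1, mem_sinks_of_eq_singleton (Prod.mk.inj hj).2⟩

lemma exists_pos_succ_eq_pos_U {v w : σ.forest.Node} (hvw : σ.forest.graph.Adj v w) :
    ∃ (s : DyckStep) (x : σ.forest.Node), pos U v = pos s x + 1 := by
  obtain ⟨i, hi⟩ := Nat.exists_eq_succ_of_ne_zero fun h => mem_sinks_of_pos_eq_zero h w hvw
  have hlt := (List.getElem?_eq_some_iff.1 (getElem?_toList_pos U v)).1
  obtain ⟨s, x, rfl⟩ := exists_eq_pos (σ := σ) (i := i) (by omega)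
  exact ⟨s, x, hi⟩

lemma pos_U_of_eq_append_zero {v w : σ.forest.Node} (h : v.1 = w.1 ++ [0]) :
    pos U v = pos U w + 1 := by
  obtain ⟨s, x, hx⟩ := exists_pos_succ_eq_pos_U ⟨0, h⟩
  have hnext := nextLabel_of_pos_eq_succ hx
  rw [h] at hnext
  generalize hx' : x.1 = a at hnext
  generalize ha : w.1 ++ [0] = a' at hnext
  rcases hnext with a | _ | ⟨a, j⟩ | _
  · obtain rfl : w = x := Subtype.ext ((List.append_inj_left' ha rfl).trans hx'.symm)
    exact hx
  · simpa using List.append_inj_right' ha rfl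

lemma exists_pos_U_of_eq_append_succ {v w : σ.forest.Node} {j : ℕ} (h : v.1 = w.1 ++ [j + 1]) :
    ∃ x : σ.forest.Node, x.1 = w.1 ++ [j] ∧ pos U v = pos D x + 1 := by
  obtain ⟨s, x, hx⟩ := exists_pos_succ_eq_pos_U ⟨j + 1, h⟩
  have hnext := nextLabel_of_pos_eq_succ hx
  rw [h] at hnext
  generalize hx' : x.1 = a at hnext
  generalize ha : w.1 ++ [j + 1] = a' at hnext
  rcases hnext with a | _ | ⟨a, i⟩ | _
  · simpa using List.append_inj_right' ha rfl
  · obtain ⟨hwa, hji⟩ := List.append_inj' ha rfl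
    obtain rfl : j = i := by simpa using hji
    exact ⟨x, by rw [hx', hwa], hx⟩

lemma pos_U_succ (v : σ.forest.Node) :
    (∃ x, σ.forest.graph.Adj x v ∧ pos U x = pos U v + 1) ∨ pos D v = pos U v + 1 := by
  have hlt : pos U v + 1 < σ.toList.length := by
    by_contra! h
    simpa using (eq_D_and_mem_sinks_of_last h).1
  obtain ⟨s, x, hx⟩ := exists_eq_pos hlt
  have hnext := nextLabel_of_pos_eq_succ hx.symm
  generalize hx' : x.1 = a at hnext
  rcases hnext with _ | _
  · exact .inl ⟨x, ⟨0, hx'⟩, hx.symm⟩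
  · exact .inr (Subtype.ext hx' ▸ hx.symm)

lemma pos_D_succ {v w : σ.forest.Node} (hvw : σ.forest.graph.Adj v w) :
    (∃ x, σ.forest.graph.Adj x w ∧ pos U x = pos D v + 1) ∨ pos D w = pos D v + 1 := by
  have hlt : pos D v + 1 < σ.toList.length := by
    by_contra! h
    exact (eq_D_and_mem_sinks_of_last h).2 w hvw
  obtain ⟨s, x, hx⟩ := exists_eq_pos hlt
  have hnext := nextLabel_of_pos_eq_succ hx.symm
  obtain ⟨i, hi⟩ := hvw
  rw [hi] at hnext
  generalize hx' : x.1 = a at hnext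
  generalize ha : w.1 ++ [i] = a' at hnext
  rcases hnext with _ | _ | ⟨a, j⟩ | ⟨_, j⟩
  · exact .inl ⟨x, ⟨j + 1, by rw [hx', List.append_inj_left' ha rfl]⟩, hx.symm⟩
  · obtain rfl : w = x := Subtype.ext ((List.append_inj_left' ha rfl).trans hx'.symm)
    exact .inr hx.symm

/-- The positions of the brackets of the nodes in `S`. -/
def positions (S : Set σ.forest.Node) : Set ℕ := {i | ∃ s, ∃ v ∈ S, i = pos s v}

lemma pos_mem_positions {S : Set σ.forest.Node} {s : DyckStep} {v : σ.forest.Node} :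
    pos s v ∈ positions S ↔ v ∈ S := by
  constructor
  · rintro ⟨s', v', hv', h⟩
    exact (pos_injective h).2 ▸ hv'
  · exact fun hv => ⟨s, v, hv, rfl⟩

lemma finite_positions (S : Set σ.forest.Node) : (positions S).Finite := by
  have hunion : positions S = pos U '' S ∪ pos D '' S := by
    ext i
    constructor
    · rintro ⟨_ | _, v, hv, rfl⟩
      exacts [.inl ⟨v, hv, rfl⟩, .inr ⟨v, hv, rfl⟩]
    · rintro (⟨v, hv, rfl⟩ | ⟨v, hv, rfl⟩) <;> exact pos_mem_positions.2 hv
  rw [hunion]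
  exact (S.toFinite.image _).union (S.toFinite.image _)

/-- The node `w` is the innermost one whose brackets enclose the gap after the position `i`. -/
lemma exists_boundary_of_mem_splitNodes {S : Set σ.forest.Node} {w : σ.forest.Node}
    (hw : w ∈ splitNodes σ.forest.graph S) :
    ∃ i, ¬ (i ∈ positions S ↔ i + 1 ∈ positions S) ∧
      (i = pos U w ∨ ∃ x, σ.forest.graph.Adj x w ∧ i = pos D x) := by
  by_contra hno
  have agree (i : ℕ) (hi : i = pos U w ∨ ∃ x, σ.forest.graph.Adj x w ∧ i = pos D x) :
      i ∈ positions S ↔ i + 1 ∈ positions S := by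
    by_contra h
    exact hno ⟨i, h, hi⟩
  obtain ⟨x, ⟨j, hx⟩, hsplit⟩ := hw
  refine hsplit ?_
  clear hsplit
  induction j generalizing x with
  | zero =>
    have := agree _ (.inl rfl)
    rwa [← pos_U_of_eq_append_zero hx, pos_mem_positions, pos_mem_positions, iff_comm] at this
  | succ j ih =>
    obtain ⟨y, hy, hpos⟩ := exists_pos_U_of_eq_append_succ hx
    have := agree _ (.inr ⟨y, ⟨j, hy⟩, rfl⟩)
    rw [← hpos, pos_mem_positions, pos_mem_positions] at this
    exact this.symm.trans (ih y hy)

lemma ncard_splitNodes_le (S : Set σ.forest.Node) :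
    (splitNodes σ.forest.graph S).ncard ≤ 2 * setWidth (positions S) := by
  choose! gap hgap hmem using fun w => exists_boundary_of_mem_splitNodes (S := S) (w := w)
  have hinj : (splitNodes σ.forest.graph S).InjOn gap := by
    intro w hw w' hw' h
    rcases hmem w hw with hpos | ⟨x, hx, hpos⟩ <;>
      rcases hmem w' hw' with hpos' | ⟨x', hx', hpos'⟩ <;>
      obtain ⟨hs, rfl⟩ := pos_injective (hpos.symm.trans (h.trans hpos'))
    · rfl
    · simp at hs
    · simp at hs
    · exact graph_rightUnique hx hx'
  have hfin : {i | ¬ (i ∈ positions S ↔ i + 1 ∈ positions S)}.Finite := by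
    refine ((finite_positions S).union ((finite_positions S).preimage
      (Nat.succ_injective.injOn))).subset fun i hi => ?_
    by_contra h
    simp_all
  exact (Set.ncard_le_ncard_of_injOn gap hgap hinj hfin).trans
    (ncard_boundary_le_two_mul_setWidth (finite_positions S))

lemma mem_image_pos_of_exit {S : Set σ.forest.Node} {i : ℕ} (hi : i ∈ positions S)
    (hi' : i + 1 ∉ positions S) :
    i ∈ pos U '' splitNodes σ.forest.graph S ∪ (pos D '' predecessors σ.forest.graph
      (splitNodes σ.forest.graph S) ∪ pos D '' sinks σ.forest.graph) := by
  obtain ⟨_ | _, v, hv, rfl⟩ := hi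
  · rcases pos_U_succ v with ⟨x, hxv, hx⟩ | hD
    · rw [← hx, pos_mem_positions] at hi'
      exact .inl ⟨v, ⟨x, hxv, by tauto⟩, rfl⟩
    · rw [← hD, pos_mem_positions] at hi'
      exact absurd hv hi'
  · by_cases hsink : v ∈ sinks σ.forest.graph
    · exact .inr (.inr ⟨v, hsink, rfl⟩)
    simp only [sinks, Set.mem_ofPred_eq, not_forall, not_not] at hsink
    obtain ⟨w, hvw⟩ := hsink
    refine .inr (.inl ⟨v, ⟨w, ?_, hvw⟩, rfl⟩)
    by_cases hw : w ∈ S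
    · rcases pos_D_succ hvw with ⟨x, hxw, hx⟩ | hD
      · rw [← hx, pos_mem_positions] at hi'
        exact ⟨x, hxw, by tauto⟩
      · rw [← hD, pos_mem_positions] at hi'
        exact absurd hw hi'
    · exact ⟨v, hvw, by tauto⟩

lemma setWidth_positions_le {d : ℕ}
    (hd : ∀ w : σ.forest.Node, {x | σ.forest.graph.Adj x w}.ncard ≤ d) (S : Set σ.forest.Node) :
    setWidth (positions S) ≤
      (d + 1) * (splitNodes σ.forest.graph S).ncard + (sinks σ.forest.graph).ncard := by
  set M := splitNodes σ.forest.graph S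
  calc setWidth (positions S) ≤ {i ∈ positions S | i + 1 ∉ positions S}.ncard :=
        setWidth_le_ncard (finite_positions S)
    _ ≤ (pos U '' M ∪ (pos D '' predecessors σ.forest.graph M ∪
          pos D '' sinks σ.forest.graph)).ncard :=
        Set.ncard_le_ncard (fun i hi => mem_image_pos_of_exit hi.1 hi.2) (Set.toFinite _)
    _ ≤ (pos U '' M).ncard + ((pos D '' predecessors σ.forest.graph M).ncard +
          (pos D '' sinks σ.forest.graph).ncard) :=
        (Set.ncard_union_le _ _).trans (by grw [Set.ncard_union_le])
    _ ≤ M.ncard + (d * M.ncard + (sinks σ.forest.graph).ncard) := by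
        grw [Set.ncard_image_le M.toFinite, Set.ncard_image_le (Set.toFinite _),
          Set.ncard_image_le (Set.toFinite _), ncard_predecessors_le hd]
    _ = (d + 1) * M.ncard + (sinks σ.forest.graph).ncard := by ring

section Enumerations

/-- The pair of the positions of the two brackets of the node `v`. -/
def bracketPair (v : σ.forest.Node) : ℕ × ℕ := (pos U v, pos D v)

lemma two_mul_card_node (σ : DyckWord) : 2 * Nat.card σ.forest.Node = σ.toList.length := by
  have hrange : Set.Iio σ.toList.length =
      Set.range (pos U : σ.forest.Node → ℕ) ∪ Set.range (pos D : σ.forest.Node → ℕ) := by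
    ext i
    constructor
    · intro hi
      obtain ⟨_ | _, v, rfl⟩ := exists_eq_pos hi
      exacts [.inl ⟨v, rfl⟩, .inr ⟨v, rfl⟩]
    · rintro (⟨v, rfl⟩ | ⟨v, rfl⟩) <;>
        exact (List.getElem?_eq_some_iff.1 (getElem?_toList_pos _ v)).1
  have hdisj : Disjoint (Set.range (pos U : σ.forest.Node → ℕ))
      (Set.range (pos D : σ.forest.Node → ℕ)) := by
    rw [Set.disjoint_left]
    rintro _ ⟨v, rfl⟩ ⟨v', h⟩
    simpa using (pos_injective h).1
  have hcard (s : DyckStep) : (Set.range (pos s : σ.forest.Node → ℕ)).ncard =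
      Nat.card σ.forest.Node :=
    Nat.card_range_of_injective fun _ _ h => (pos_injective h).2
  have := congrArg Set.ncard hrange
  rw [Set.ncard_union_eq hdisj (Set.toFinite _) (Set.toFinite _), hcard, hcard] at this
  rw [two_mul, ← this]
  simp

lemma length_eq_semilength {l : List σ.forest.Node} (hl : l.Nodup) (hmem : ∀ v, v ∈ l) :
    l.length = σ.semilength := by
  classical
  have hcard := Nat.card_eq_of_equiv_fin (hl.getEquivOfForallMemList l hmem).symm
  have := two_mul_card_node σ
  have := σ.two_mul_semilength_eq_length
  omega

lemma isSimpleRepairing_map_bracketPair {l : List σ.forest.Node} (hl : l.Nodup)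
    (hmem : ∀ v, v ∈ l) : σ.IsSimpleRepairing (l.map bracketPair) where
  length_eq := by rw [List.length_map, length_eq_semilength hl hmem]
  signs := by
    simp only [List.mem_map, forall_exists_index, and_imp, forall_apply_eq_imp_iff₂]
    exact fun v _ => ⟨getElem?_toList_pos U v, getElem?_toList_pos D v,
      lt_of_matched (matched_iff_exists_pos.2 ⟨v, rfl, rfl⟩)⟩
  exactly_one i hi := by
    obtain ⟨s, v, rfl⟩ := exists_eq_pos hi
    obtain ⟨k, hk, hkv⟩ := List.getElem_of_mem (hmem v)
    refine ⟨⟨k, by simpa using hk⟩, ?_, fun k' hk' => ?_⟩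
    · cases s <;> simp [bracketPair, hkv]
    · have hk'v : l[k'.1]'(by simpa using k'.2) = v := by
        simp only [List.get_eq_getElem, List.getElem_map] at hk'
        rcases hk' with h | h <;> exact (pos_injective h).2
      exact Fin.ext ((hl.getElem_inj_iff).1 (hk'v.trans hkv.symm))
  simple := by
    simp only [List.mem_map, forall_exists_index, and_imp, forall_apply_eq_imp_iff₂]
    exact fun v _ => matched_iff_exists_pos.2 ⟨v, rfl, rfl⟩

lemma exists_enumeration_of_isSimpleRepairing {p : List (ℕ × ℕ)} (hp : σ.IsSimpleRepairing p) :
    ∃ l : List σ.forest.Node, l.Nodup ∧ (∀ v, v ∈ l) ∧ l.map bracketPair = p := by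
  have hnodes : p ∈ Set.range (List.map (bracketPair (σ := σ))) := by
    rw [Set.range_list_map]
    intro q hq
    obtain ⟨v, hU, hD⟩ := matched_iff_exists_pos.1 (hp.simple q hq)
    exact ⟨v, Prod.ext hU.symm hD.symm⟩
  have hnodup : p.Nodup := by
    rw [List.nodup_iff_injective_get]
    intro k k' h
    have hlt := (List.getElem?_eq_some_iff.1 (hp.signs _ (p.get_mem k)).1).1
    exact (hp.exactly_one _ hlt).unique (.inl rfl) (.inl (congrArg Prod.fst h.symm))
  obtain ⟨l, rfl⟩ := hnodes
  refine ⟨l, hnodup.of_map _, fun v => ?_, rfl⟩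
  have hlt := (List.getElem?_eq_some_iff.1 (getElem?_toList_pos U v)).1
  obtain ⟨k, hk, -⟩ := hp.exactly_one _ hlt
  simp only [List.get_eq_getElem, List.getElem_map] at hk
  have hkv : l[k.1]'(by simpa using k.2) = v := by
    rcases hk with h | h <;> exact (pos_injective h).2
  exact hkv ▸ List.getElem_mem _

lemma erased_map_bracketPair (l : List σ.forest.Node) (t : ℕ) :
    erased (l.map bracketPair) t = positions {v | v ∈ l.take t} := by
  ext i
  simp only [erased, ← List.map_take, List.mem_map, positions, Set.mem_ofPred_eq]
  constructor
  · rintro ⟨_, ⟨v, hv, rfl⟩, rfl | rfl⟩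
    exacts [⟨U, v, hv, rfl⟩, ⟨D, v, hv, rfl⟩]
  · rintro ⟨_ | _, v, hv, rfl⟩
    exacts [⟨_, ⟨v, hv, rfl⟩, .inl rfl⟩, ⟨_, ⟨v, hv, rfl⟩, .inr rfl⟩]

lemma ncard_splitNodes_take_le {l : List σ.forest.Node} {t : ℕ} (ht : t ≤ l.length) :
    (splitNodes σ.forest.graph {v | v ∈ l.take t}).ncard ≤ 2 * width (l.map bracketPair) := by
  grw [ncard_splitNodes_le, ← erased_map_bracketPair,
    setWidth_erased_le_width (by rwa [List.length_map])]

lemma width_map_bracketPair_le {d m : ℕ}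
    (hd : ∀ w : σ.forest.Node, {x | σ.forest.graph.Adj x w}.ncard ≤ d) {l : List σ.forest.Node}
    (hm : ∀ t, (splitNodes σ.forest.graph {v | v ∈ l.take t}).ncard ≤ m) :
    width (l.map bracketPair) ≤ (d + 1) * m + (sinks σ.forest.graph).ncard := by
  refine Finset.sup_le fun t _ => ?_
  grw [erased_map_bracketPair, setWidth_positions_le hd, hm]

end Enumerations

end Bracketing

namespace Pebbling

variable {V : Type*} {G : Digraph V}

/-- The configurations that can be reached with at most `k` pebbles on the graph at any time. -/
inductive Reachable [DecidableEq V] (G : Digraph V) (k : ℕ) : Config V → Prop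
  | start : Reachable G k fun _ => none
  | move {c c' : Config V} (hc : Reachable G k c) (h : Move G c c') (hk : c'.numPebbles ≤ k) :
      Reachable G k c'

lemma Config.numPebbles_le_of_imp [Finite V] {c c' : Config V} (h : ∀ u, c u ≠ none → c' u ≠ none) :
    c.numPebbles ≤ c'.numPebbles :=
  Set.ncard_le_ncard h (Set.toFinite _)

section Reachable

variable [DecidableEq V] {k : ℕ} {c : Config V}

lemma Reachable.numPebbles_le (hc : Reachable G k c) : c.numPebbles ≤ k := by
  cases hc with
  | start => simp [Config.numPebbles]
  | move _ _ hk => exact hk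

lemma Reachable.exists_isStrategy (hc : Reachable G k c) : ∃ s : List (Config V),
    IsStrategy G s ∧ s.getLast? = some c ∧ ∀ c ∈ s, c.numPebbles ≤ k := by
  induction hc with
  | start =>
    exact ⟨[fun _ => none], ⟨rfl, .singleton _⟩, rfl, by simp [Config.numPebbles]⟩
  | @move c c' _ h hk ih =>
    obtain ⟨s, hs, hlast, hbound⟩ := ih
    refine ⟨s ++ [c'], ⟨?_, ?_⟩, by simp, ?_⟩
    · rw [List.head?_append, hs.start, Option.some_or]
    · refine List.isChain_append.2 ⟨hs.moves, .singleton _, ?_⟩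
      simpa [hlast] using h
    · simpa [or_imp, forall_and, hk] using hbound

lemma Reachable.mem_sufficientPebbles (hc : Reachable G k c) (hgoal : IsGoal G c) :
    k ∈ sufficientPebbles G := by
  obtain ⟨s, hs, hlast, hbound⟩ := hc.exists_isStrategy
  exact ⟨s, hs, ⟨c, List.mem_of_getLast? hlast, hgoal⟩, hbound⟩

variable [Finite V]

lemma Reachable.placeWhite (hc : Reachable G k c) {v : V} (hv : c v = none)
    (hk : c.numPebbles + 1 ≤ k) : Reachable G k (Function.update c v (some .white)) := by
  refine hc.move (.placeWhite c v hv) (le_trans ?_ hk)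
  refine (Set.ncard_le_ncard fun u hu => ?_).trans (Set.ncard_insert_le v {u | c u ≠ none})
  rcases eq_or_ne u v with rfl | huv
  · exact Set.mem_insert _ _
  · exact .inr (by simpa [huv] using hu)

lemma Reachable.repaint (hG : Std.Irrefl G.Adj) (hc : Reachable G k c) {v : V}
    (hv : c v = some .white) (hpred : PredecessorsPebbled G c v) :
    Reachable G k (Function.update c v (some .black)) := by
  have hremove : Reachable G k (Function.update c v none) := by
    refine hc.move (.removeWhite c v hv hpred)
      ((Config.numPebbles_le_of_imp fun u hu => ?_).trans hc.numPebbles_le)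
    rcases eq_or_ne u v with rfl | huv
    · simp at hu
    · simpa [huv] using hu
  have hplace := Move.placeBlack (G := G) (Function.update c v none) v (by simp) fun u hu => by
    have huv : u ≠ v := fun h => hG.irrefl v (h ▸ hu)
    simpa [huv] using hpred u hu
  rw [Function.update_idem] at hplace
  refine hremove.move hplace ((Config.numPebbles_le_of_imp fun u hu => ?_).trans hc.numPebbles_le)
  rcases eq_or_ne u v with rfl | huv
  · simp [hv]
  · simpa [huv] using hu

lemma Reachable.exists_repaint (hG : Std.Irrefl G.Adj) (hc : Reachable G k c) :
    ∃ c', Reachable G k c' ∧ (∀ u, c' u = none ↔ c u = none) ∧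
      ∀ u, c' u = some .white → c u = some .white ∧ ¬ PredecessorsPebbled G c u := by
  classical
  suffices h : ∀ B : Finset V, ∃ c', Reachable G k c' ∧ (∀ u, c' u = none ↔ c u = none) ∧
      ∀ u, c' u = some .white → c u = some .white ∧ (u ∈ B → ¬ PredecessorsPebbled G c u) by
    obtain ⟨c', hreach, hnone, hwhite⟩ := h (Set.finite_univ (α := V)).toFinset
    exact ⟨c', hreach, hnone, fun u hu => (hwhite u hu).imp_right fun h => h (by simp)⟩
  intro B
  induction B using Finset.induction_on with
  | empty => exact ⟨c, hc, fun _ => .rfl, fun u hu => ⟨hu, by simp⟩⟩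
  | insert b B _ ih =>
    obtain ⟨c', hreach, hnone, hwhite⟩ := ih
    by_cases hb : c' b = some .white ∧ PredecessorsPebbled G c b
    · refine ⟨Function.update c' b (some .black), hreach.repaint hG hb.1 fun u hu =>
        (hnone u).not.2 (hb.2 u hu), fun u => ?_, fun u hu => ?_⟩
      · rcases eq_or_ne u b with rfl | hub
        · simp [(hwhite u hb.1).1]
        · simpa [hub] using hnone u
      · rcases eq_or_ne u b with rfl | hub
        · simp at hu
        · simpa [hub] using hwhite u (by simpa [hub] using hu)
    · refine ⟨c', hreach, hnone, fun u hu => ⟨(hwhite u hu).1, fun h => ?_⟩⟩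
      rcases Finset.mem_insert.1 h with rfl | h
      · exact fun hpred => hb ⟨hu, hpred⟩
      · exact (hwhite u hu).2 h

open Classical in
lemma Reachable.removeBlack (hc : Reachable G k c) {Q : Set V}
    (hQ : ∀ u ∉ Q, c u ≠ some .white) : Reachable G k (Q.piecewise c fun _ => none) := by
  suffices h : ∀ B : Finset V, (∀ u ∈ B, c u ≠ some .white) →
      Reachable G k fun u => if u ∈ B then none else c u by
    have hfin := Qᶜ.toFinite
    convert h hfin.toFinset (by simpa using hQ) using 1
    ext1 u
    by_cases hu : u ∈ Q <;> simp [hu]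
  intro B hB
  induction B using Finset.induction_on with
  | empty => simpa using hc
  | insert b B hbB ih =>
    have hreach := ih fun u hu => hB u (Finset.mem_insert_of_mem hu)
    have hupdate : (fun u => if u ∈ insert b B then none else c u) =
        Function.update (fun u => if u ∈ B then none else c u) b none := by
      ext1 u
      rcases eq_or_ne u b with rfl | hub
      · simp
      · simp [hub]
    rw [hupdate]
    rcases hcb : c b with _ | _ | _
    · rwa [Function.update_eq_self_iff.2]
      simp [hcb]
    · refine hreach.move (.removeBlack _ b (by simp [hbB, hcb]))
        ((Config.numPebbles_le_of_imp fun u hu => ?_).trans hreach.numPebbles_le)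
      rcases eq_or_ne u b with rfl | hub
      · simp at hu
      · simpa [hub] using hu
    · exact absurd hcb (hB b (Finset.mem_insert_self _ _))

end Reachable

section Stages

/-- The node and all its immediate predecessors belong to `S`. -/
def Done (G : Digraph V) (S : Set V) (v : V) : Prop := v ∈ S ∧ ∀ u, G.Adj u v → u ∈ S

/-- The nodes that carry pebbles when the nodes in `S` have been dealt with: a node of `S` keeps its
pebble until both it and its successor are done. -/
def pending (G : Digraph V) (S : Set V) : Set V :=
  {u ∈ S | Done G S u → ∀ w, G.Adj u w → ¬ Done G S w}

/-- A configuration suitable for the time when the nodes in `S` have been dealt with. -/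
structure IsStage (G : Digraph V) (S : Set V) (c : Config V) : Prop where
  ne_none_iff : ∀ u, c u ≠ none ↔ u ∈ pending G S
  not_done : ∀ u, c u = some .white → ¬ Done G S u

lemma Done.mono {S S' : Set V} (h : S ⊆ S') {v : V} (hv : Done G S v) : Done G S' v :=
  ⟨h hv.1, fun u hu => h (hv.2 u hu)⟩

lemma pending_subset_union (S : Set V) :
    pending G S ⊆ splitNodes G S ∪ (predecessors G (splitNodes G S) ∪ sinks G) := by
  have mem_splitNodes {w x : V} (hxw : G.Adj x w) (hx : x ∈ S) (hw : ¬ Done G S w) :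
      w ∈ splitNodes G S := by
    by_contra hsplit
    simp only [splitNodes, Set.mem_ofPred_eq, not_exists, not_and, not_not] at hsplit
    have hwS := (hsplit x hxw).1 hx
    exact hw ⟨hwS, fun y hy => (hsplit y hy).2 hwS⟩
  rintro u ⟨hu, hpending⟩
  by_cases hdone : Done G S u
  · by_cases hsink : u ∈ sinks G
    · exact .inr (.inr hsink)
    · simp only [sinks, Set.mem_ofPred_eq, not_forall, not_not] at hsink
      obtain ⟨w, huw⟩ := hsink
      exact .inr (.inl ⟨w, mem_splitNodes huw hu (hpending hdone w huw), huw⟩)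
  · simp only [Done, hu, true_and, not_forall] at hdone
    obtain ⟨x, hxu, hx⟩ := hdone
    exact .inl ⟨x, hxu, by tauto⟩

lemma IsStage.numPebbles_le [Finite V] {S : Set V} {c : Config V} (hc : IsStage G S c) {d : ℕ}
    (hd : ∀ w, {x | G.Adj x w}.ncard ≤ d) :
    c.numPebbles ≤ (d + 1) * (splitNodes G S).ncard + (sinks G).ncard := by
  have hpending : {u | c u ≠ none} = pending G S := Set.ext hc.ne_none_iff
  rw [Config.numPebbles, hpending]
  grw [pending_subset_union, Set.ncard_union_le, Set.ncard_union_le, ncard_predecessors_le hd]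
  · exact le_of_eq (by ring)
  · exact Set.toFinite _

lemma isStage_empty : IsStage G ∅ fun _ => none where
  ne_none_iff := by simp [pending]
  not_done := by simp

lemma IsStage.isGoal {c : Config V} (hc : IsStage G Set.univ c) : IsGoal G c := by
  have done (v : V) : Done G Set.univ v := by simp [Done]
  exact ⟨fun v hv => (hc.ne_none_iff v).2 ⟨trivial, fun _ w hw => (hv w hw).elim⟩,
    fun v hv => hc.not_done v hv (done v)⟩

variable [Finite V] [DecidableEq V] {k : ℕ}

lemma Reachable.exists_isStage {S : Set V} {c : Config V} (hreach : Reachable G k c)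
    (hS : ∀ u, c u ≠ none → u ∈ S) (hpending : ∀ u ∈ pending G S, c u ≠ none)
    (hwhite : ∀ u, c u = some .white → ¬ Done G S u) : ∃ c', IsStage G S c' ∧ Reachable G k c' := by
  classical
  have black_of_notMem_pending (u : V) (hu : u ∉ pending G S) : c u ≠ some .white := fun h =>
    hu ⟨hS u (by simp [h]), fun hdone => absurd hdone (hwhite u h)⟩
  refine ⟨(pending G S).piecewise c fun _ => none, ⟨fun u => ?_, fun u hu => ?_⟩,
    hreach.removeBlack black_of_notMem_pending⟩ <;>
  by_cases hmem : u ∈ pending G S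
  · simp [hmem, hpending u hmem]
  · simp [hmem]
  · exact hwhite u (by simpa [hmem] using hu)
  · simp [hmem] at hu

lemma IsStage.exists_insert (hirr : Std.Irrefl G.Adj) (huniq : Relator.RightUnique G.Adj)
    {S : Set V} {c : Config V} (hc : IsStage G S c) (hreach : Reachable G k c)
    (hk : c.numPebbles + 1 ≤ k) (v : V) : ∃ c', IsStage G (insert v S) c' ∧ Reachable G k c' := by
  by_cases hv : v ∈ S
  · exact ⟨c, (Set.insert_eq_of_mem hv).symm ▸ hc, hreach⟩
  have hcv : c v = none := by
    by_contra h
    exact hv ((hc.ne_none_iff v).1 h).1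
  set c₁ := Function.update c v (some .white)
  have hc₁ (u : V) (hu : u ≠ v) : c₁ u = c u := Function.update_of_ne hu _ _
  obtain ⟨c₂, hreach₂, hnone, hwhite⟩ := (hreach.placeWhite hcv hk).exists_repaint hirr
  refine hreach₂.exists_isStage (fun u hu => ?mem) (fun u hu => ?pebbled) fun u hu => ?not_done
  case mem =>
    rcases eq_or_ne u v with rfl | huv
    · exact Set.mem_insert _ _
    · exact .inr ((hc.ne_none_iff u).1 (hc₁ u huv ▸ (hnone u).not.1 hu)).1
  case pebbled =>
    refine (hnone u).not.2 ?_
    rcases eq_or_ne u v with rfl | huv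
    · simp
    · refine (hc₁ u huv).trans_ne <| (hc.ne_none_iff u).2
        ⟨hu.1.resolve_left huv, fun hdone w huw hw => hu.2
          (hdone.mono (Set.subset_insert v S)) w huw (hw.mono (Set.subset_insert v S))⟩
  case not_done =>
    obtain ⟨hu₁, hpred⟩ := hwhite u hu
    refine fun hdone => hpred fun x hxu => ?_
    rcases eq_or_ne x v with rfl | hxv
    · simp
    have hxS : x ∈ S := (hdone.2 x hxu).resolve_left hxv
    refine (hc₁ x hxv).trans_ne <| (hc.ne_none_iff x).2 ⟨hxS, fun _ w hxw hw => ?_⟩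
    obtain rfl := huniq hxw hxu
    have hwv : w ≠ v := fun h => hv (h ▸ hw.1)
    exact hc.not_done w (hc₁ w hwv ▸ hu₁) hw

lemma mem_sufficientPebbles_of_enumeration (hirr : Std.Irrefl G.Adj)
    (huniq : Relator.RightUnique G.Adj) {d : ℕ} (hd : ∀ w, {x | G.Adj x w}.ncard ≤ d) {l : List V}
    (hl : ∀ v, v ∈ l) (hk : ∀ t < l.length,
      (d + 1) * (splitNodes G {v | v ∈ l.take t}).ncard + (sinks G).ncard + 1 ≤ k) :
    k ∈ sufficientPebbles G := by
  have hstage (t : ℕ) (ht : t ≤ l.length) :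
      ∃ c, IsStage G {v | v ∈ l.take t} c ∧ Reachable G k c := by
    induction t with
    | zero => exact ⟨_, by simpa using isStage_empty, .start⟩
    | succ t ih =>
      obtain ⟨c, hc, hreach⟩ := ih (by omega)
      have hinsert : {v | v ∈ l.take (t + 1)} = insert l[t] {v | v ∈ l.take t} := by
        ext v
        rw [List.take_succ_eq_append_getElem ht]
        simp only [Set.mem_ofPred_eq, List.mem_append, List.mem_singleton, Set.mem_insert_iff,
          or_comm]
      rw [hinsert]
      exact hc.exists_insert hirr huniq hreach
        (le_trans (by grw [hc.numPebbles_le hd]) (hk t ht)) l[t]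
  obtain ⟨c, hc, hreach⟩ := hstage l.length le_rfl
  have huniv : {v | v ∈ l} = Set.univ := Set.eq_univ_of_forall hl
  rw [List.take_length, huniv] at hc
  exact hreach.mem_sufficientPebbles hc.isGoal

end Stages

end Pebbling

namespace Pebbling

variable {V : Type*} {G : Digraph V}

section Enumerations

variable [Finite V]

lemma exists_sorted_enumeration (f : V → ℕ) :
    ∃ l : List V, l.Nodup ∧ (∀ v, v ∈ l) ∧ l.Pairwise fun u v => f u ≤ f v := by
  obtain ⟨l, hnodup, hmem⟩ := Finite.exists_univ_list V
  have hperm := List.perm_insertionSort (fun u v => f u ≤ f v) l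
  have : Std.Total fun u v : V => f u ≤ f v := ⟨fun u v => le_total (f u) (f v)⟩
  have : IsTrans V fun u v => f u ≤ f v := ⟨fun _ _ _ => le_trans⟩
  exact ⟨_, hperm.nodup_iff.2 hnodup, fun v => hperm.mem_iff.2 (hmem v),
    List.pairwise_insertionSort _ l⟩

lemma exists_threshold_enumeration (f : V → ℕ) : ∃ l : List V, l.Nodup ∧ (∀ v, v ∈ l) ∧
    ∀ t, ∃ θ, (∀ v ∈ l.take t, f v ≤ θ) ∧ ∀ v ∉ l.take t, θ ≤ f v := by
  classical
  obtain ⟨l, hnodup, hmem, hsorted⟩ := exists_sorted_enumeration f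
  refine ⟨l, hnodup, hmem, fun t => ⟨(l.take t).toFinset.sup f,
    fun v hv => Finset.le_sup (f := f) (List.mem_toFinset.2 hv), fun v hv => ?_⟩⟩
  rw [← l.take_append_drop t, List.pairwise_append] at hsorted
  have hdrop : v ∈ l.drop t :=
    (List.mem_append.1 ((l.take_append_drop t).symm ▸ hmem v)).resolve_left hv
  exact Finset.sup_le fun u hu => hsorted.2.2 u (List.mem_toFinset.1 hu) v hdrop

lemma ncard_splitNodes_le_two_mul (huniq : Relator.RightUnique G.Adj) {S A : Set V}
    (hA : ∀ u v, G.Adj u v → ¬ (u ∈ S ↔ v ∈ S) → u ∈ A ∨ v ∈ A) :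
    (splitNodes G S).ncard ≤ 2 * A.ncard := by
  have hcover (w : V) (hw : w ∈ splitNodes G S) : w ∈ A ∪ {w | ∃ x ∈ A, G.Adj x w} := by
    obtain ⟨x, hxw, hsplit⟩ := hw
    exact (hA x w hxw hsplit).symm.imp_right fun hx => ⟨x, hx, hxw⟩
  have hsucc : {w | ∃ x ∈ A, G.Adj x w}.ncard ≤ A.ncard := by
    choose! x hx using fun w (hw : w ∈ {w | ∃ x ∈ A, G.Adj x w}) => hw
    refine Set.ncard_le_ncard_of_injOn x (fun w hw => (hx w hw).1) fun w hw w' hw' heq => ?_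
    exact huniq (hx w hw).2 (heq ▸ (hx w' hw').2)
  grw [Set.ncard_le_ncard hcover (Set.toFinite _), Set.ncard_union_le, hsucc, two_mul]

end Enumerations

variable [DecidableEq V]

lemma Move.black_or_predecessorsPebbled (hirr : Std.Irrefl G.Adj) {c c' : Config V}
    (h : Move G c c') {v : V} (hv : c' v = some .black) :
    c v = some .black ∨ PredecessorsPebbled G c' v := by
  have unchanged (x : V) {p : Option Pebble} (hp : p ≠ some .black)
      (hv : Function.update c x p v = some .black) : c v = some .black := by
    rcases eq_or_ne v x with rfl | hvx
    · simp [hp] at hv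
    · simpa [hvx] using hv
  cases h with
  | placeBlack x hx hpred =>
    rcases eq_or_ne v x with rfl | hvx
    · refine .inr fun u hu => ?_
      have huv : u ≠ v := fun h => hirr.irrefl v (h ▸ hu)
      simpa [huv] using hpred u hu
    · exact .inl (by simpa [hvx] using hv)
  | removeBlack x => exact .inl (unchanged x (by simp) hv)
  | placeWhite x => exact .inl (unchanged x (by simp) hv)
  | removeWhite x => exact .inl (unchanged x (by simp) hv)

lemma Move.white_or_predecessorsPebbled {c c' : Config V} (h : Move G c c') {v : V}
    (hv : c v = some .white) :
    c' v = some .white ∨ PredecessorsPebbled G c v := by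
  have unchanged {x : V} (p : Option Pebble) (hx : c x ≠ some .white) :
      Function.update c x p v = some .white := by
    have hvx : v ≠ x := fun h => hx (h ▸ hv)
    simpa [hvx] using hv
  cases h with
  | placeBlack x hx => exact .inl (unchanged _ (by simp [hx]))
  | removeBlack x hx => exact .inl (unchanged _ (by simp [hx]))
  | placeWhite x hx => exact .inl (unchanged _ (by simp [hx]))
  | removeWhite x hx hpred =>
    rcases eq_or_ne v x with rfl | hvx
    · exact .inr hpred
    · exact .inl (by simpa [hvx] using hv)

/-- The configurations `c 0, …, c T` form a successful sequence of moves; the later ones are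
irrelevant. -/
structure IsPlay (G : Digraph V) (c : ℕ → Config V) (T : ℕ) : Prop where
  start : c 0 = fun _ => none
  move : ∀ t < T, Move G (c t) (c (t + 1))
  isGoal : IsGoal G (c T)

lemma exists_isPlay_of_mem_sufficientPebbles {k : ℕ} (hk : k ∈ sufficientPebbles G) :
    ∃ c T, IsPlay G c T ∧ ∀ t, (c t).numPebbles ≤ k := by
  obtain ⟨s, hs, ⟨_, hmem, hgoal⟩, hbound⟩ := hk
  obtain ⟨T, hT, rfl⟩ := List.mem_iff_getElem.1 hmem
  refine ⟨fun t => s[min t T], T, ⟨?_, fun t ht => ?_, by simpa⟩, fun t => hbound _ (by simp)⟩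
  · have hstart := hs.start
    rw [List.head?_eq_getElem?, List.getElem?_eq_getElem (by omega)] at hstart
    simpa using hstart
  · simpa [ht.le, Nat.succ_le_of_lt ht] using List.isChain_iff_getElem.1 hs.moves t (by omega)

lemma IsPlay.exists_predecessorsPebbled (hirr : Std.Irrefl G.Adj) {c : ℕ → Config V} {T : ℕ}
    (hc : IsPlay G c T) {v : V} {t : ℕ} (ht : t ≤ T) (hv : c t v ≠ none) :
    ∃ τ ≤ T, PredecessorsPebbled G (c τ) v ∧ ∀ t' ∈ Set.uIcc t τ, c t' v ≠ none := by
  rcases hcolor : c t v with _ | _ | _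
  · exact absurd hcolor hv
  · clear hv
    induction t with
    | zero => simp [hc.start] at hcolor
    | succ t ih =>
      rcases (hc.move t ht).black_or_predecessorsPebbled hirr hcolor with h | h
      · obtain ⟨τ, hτ, hpred, hpebbled⟩ := ih (by omega) h
        refine ⟨τ, hτ, hpred, fun t' ht' => ?_⟩
        rcases eq_or_ne t' (t + 1) with rfl | hne
        · simp [hcolor]
        · exact hpebbled t' (by rw [Set.mem_uIcc] at ht' ⊢; omega)
      · exact ⟨t + 1, ht, h, by simp [hcolor]⟩
  · clear hv
    induction ht using Nat.decreasingInduction with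
    | self => exact absurd hcolor (hc.isGoal.2 v)
    | of_succ t ht ih =>
      rcases (hc.move t ht).white_or_predecessorsPebbled hcolor with h | h
      · obtain ⟨τ, hτ, hpred, hpebbled⟩ := ih h
        refine ⟨τ, hτ, hpred, fun t' ht' => ?_⟩
        rcases eq_or_ne t' t with rfl | hne
        · simp [hcolor]
        · exact hpebbled t' (by rw [Set.mem_uIcc] at ht' ⊢; omega)
      · exact ⟨t, ht.le, h, by simp [hcolor]⟩

lemma ncard_sinks_le_of_mem_sufficientPebbles [Finite V] {k : ℕ} (hk : k ∈ sufficientPebbles G) :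
    (sinks G).ncard ≤ k := by
  obtain ⟨_, _, ⟨c, hc, hgoal⟩, hbound⟩ := hk
  exact (Set.ncard_le_ncard hgoal.1 (Set.toFinite _)).trans (hbound c hc)

end Pebbling

namespace OrderedForest

open Pebbling

variable {F : OrderedForest}

lemma exists_pebbled_uIcc {c : ℕ → Config F.Node} {T : ℕ} (hc : IsPlay F.graph c T) :
    ∃ e : List ℕ → ℕ, ∀ v : F.Node, ∀ t ∈ Set.uIcc (e v.1.dropLast) (e v.1), c t v ≠ none := by
  obtain ⟨e, he⟩ := exists_topDown_choice
    (Q := fun v t => t ≤ T ∧ c t v ≠ none) (R := fun v t τ => ∀ t' ∈ Set.uIcc t τ, c t' v ≠ none)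
    (x₀ := T) (fun v hv => ⟨le_rfl, hc.isGoal.1 v hv⟩) fun v t ⟨ht, hv⟩ => by
      obtain ⟨τ, hτ, hpred, hpebbled⟩ := hc.exists_predecessorsPebbled F.graph_irrefl ht hv
      exact ⟨τ, hpebbled, fun u hu => ⟨hτ, hpred u hu⟩⟩
  exact ⟨e, he⟩

lemma exists_enumeration_of_mem_sufficientPebbles [Finite F.Node] {k : ℕ}
    (hk : k ∈ sufficientPebbles F.graph) : ∃ l : List F.Node, l.Nodup ∧ (∀ v, v ∈ l) ∧
      ∀ t, (splitNodes F.graph {v | v ∈ l.take t}).ncard ≤ 2 * k := by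
  obtain ⟨c, T, hc, hbound⟩ := exists_isPlay_of_mem_sufficientPebbles hk
  obtain ⟨e, he⟩ := exists_pebbled_uIcc hc
  obtain ⟨l, hnodup, hmem, hθ⟩ :=
    exists_threshold_enumeration fun v : F.Node => min (e v.1.dropLast) (e v.1)
  refine ⟨l, hnodup, hmem, fun t => ?_⟩
  obtain ⟨θ, hle, hge⟩ := hθ t
  have hpebbled (u v : F.Node) (huv : F.graph.Adj u v)
      (hsplit : ¬ (u ∈ l.take t ↔ v ∈ l.take t)) : c θ u ≠ none ∨ c θ v ≠ none := by
    -- The time `e v.1` belongs to the intervals of both `u` and `v`.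
    have hparent : u.1.dropLast = v.1 := by
      obtain ⟨i, hi⟩ := huv
      simp [hi]
    simp only [Set.mem_uIcc] at he
    by_cases hu : u ∈ l.take t
    · have hv : v ∉ l.take t := by tauto
      have hθu := hle u hu
      have hθv := hge v hv
      rw [hparent] at hθu
      exact .inl (he u θ (by rw [hparent]; omega))
    · have hv : v ∈ l.take t := by tauto
      have hθu := hge u hu
      have hθv := hle v hv
      rw [hparent] at hθu
      exact .inr (he v θ (by omega))
  calc (splitNodes F.graph {v | v ∈ l.take t}).ncard
      ≤ 2 * (c θ).numPebbles := ncard_splitNodes_le_two_mul F.graph_rightUnique hpebbled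
    _ ≤ 2 * k := by grw [hbound θ]

end OrderedForest

namespace Bracketing

open Pebbling Repairing OrderedForest

lemma simpleWidths_nonempty (σ : DyckWord) : σ.simpleWidths.Nonempty := by
  obtain ⟨l, hnodup, hmem⟩ := Finite.exists_univ_list σ.forest.Node
  exact ⟨_, _, isSimpleRepairing_map_bracketPair hnodup hmem, rfl⟩

variable {σ : DyckWord} {d : ℕ}

lemma mul_width_mem_sufficientPebbles
    (hd : ∀ w : σ.forest.Node, {x | σ.forest.graph.Adj x w}.ncard ≤ d) {p : List (ℕ × ℕ)}
    (hp : σ.IsSimpleRepairing p) :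
    (2 * d + 3 + σ.forest.length) * width p ∈ sufficientPebbles σ.forest.graph := by
  obtain ⟨l, -, hmem, rfl⟩ := exists_enumeration_of_isSimpleRepairing hp
  refine mem_sufficientPebbles_of_enumeration graph_irrefl graph_rightUnique hd hmem fun t ht => ?_
  have hwidth : 1 ≤ width (l.map bracketPair) := width_pos <| by
    simpa using List.ne_nil_of_length_pos (by omega)
  grw [ncard_splitNodes_take_le ht.le, ncard_sinks_le_length]
  nlinarith

lemma minSimpleWidth_le_mul_of_mem_sufficientPebbles
    (hd : ∀ w : σ.forest.Node, {x | σ.forest.graph.Adj x w}.ncard ≤ d) {k : ℕ}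
    (hk : k ∈ sufficientPebbles σ.forest.graph) : σ.minSimpleWidth ≤ (2 * d + 3) * k := by
  obtain ⟨l, hnodup, hmem, hsplit⟩ := exists_enumeration_of_mem_sufficientPebbles hk
  calc σ.minSimpleWidth
      ≤ width (l.map bracketPair) :=
        Nat.sInf_le ⟨_, isSimpleRepairing_map_bracketPair hnodup hmem, rfl⟩
    _ ≤ (d + 1) * (2 * k) + k := by
        grw [width_map_bracketPair_le hd hsplit, ncard_sinks_le_of_mem_sufficientPebbles hk]
    _ = (2 * d + 3) * k := by ring

end Bracketing

theorem mainTheorem7_general (σ : DyckWord) (d : ℕ)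
    (hd : ∀ w : σ.forest.Node, {x | σ.forest.graph.Adj x w}.ncard ≤ d) :
    σ.simpleWidths.Nonempty ∧ (Pebbling.sufficientPebbles σ.forest.graph).Nonempty ∧
      Pebbling.bw σ.forest.graph ≤ (2 * d + 3 + σ.forest.length) * σ.minSimpleWidth ∧
      σ.minSimpleWidth ≤ (2 * d + 3) * Pebbling.bw σ.forest.graph := by
  have hne := Bracketing.simpleWidths_nonempty σ
  obtain ⟨p, hp, hmin⟩ := Nat.sInf_mem hne
  have hmem := Bracketing.mul_width_mem_sufficientPebbles hd hp
  refine ⟨hne, ⟨_, hmem⟩, ?_,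
    Bracketing.minSimpleWidth_le_mul_of_mem_sufficientPebbles hd (Nat.sInf_mem ⟨_, hmem⟩)⟩
  rw [DyckWord.minSimpleWidth, ← hmin]
  exact Nat.sInf_le hmem

theorem mainTheorem7 :
    ∃ c C : ℝ, 0 < c ∧ 0 < C ∧
      ∀ σ : DyckWord, σ.forest.IsTree → σ.forest.IsBinary →
        σ.simpleWidths.Nonempty ∧
        (Pebbling.sufficientPebbles σ.forest.graph).Nonempty ∧
        c * (Pebbling.bw σ.forest.graph : ℝ) ≤ (σ.minSimpleWidth : ℝ) ∧
        (σ.minSimpleWidth : ℝ) ≤ C * (Pebbling.bw σ.forest.graph : ℝ) := by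
  refine ⟨1 / 8, 7, by norm_num, by norm_num, fun σ htree hbinary => ?_⟩
  obtain ⟨hwidths, hpebbles, hbw, hwidth⟩ :=
    mainTheorem7_general σ 2 hbinary.ncard_children_le_two
  refine ⟨hwidths, hpebbles, ?_, by exact_mod_cast hwidth⟩
  have hlength : σ.forest.length ≤ 1 := htree
  have hbw' : Pebbling.bw σ.forest.graph ≤ 8 * σ.minSimpleWidth := by grw [hbw, hlength]
  have : (Pebbling.bw σ.forest.graph : ℝ) ≤ 8 * σ.minSimpleWidth := by exact_mod_cast hbw'
  linarith
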